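/- **Setting.** Let $(M,\mathbf g)$ be a smooth (Hausdorff, second countable) manifold with a smooth pseudo-Riemannian metric, for example a globally hyperbolic space-time, and let $\mathscr E=C^\infty(M,\mathbb R^n)$. Let $\mathcal F_{\rm loc}(M)$ be the space of local functionals: real functionals $F[\phi]=\int_M\hat F(x,j_x(\phi))\,d\mu_{\mathbf g}$ on $\mathscr E$, with $\hat F$ smooth, of finite order and polynomial in the jets of $\phi$, and compactly supported in $x$. The support of $F$ is the set of points $x$ such that every neighbourhood $U$ of $x$ admits $\phi,\psi\in\mathscr E$ with $\mathrm{supp}\,\psi\subset U$ and $F[\phi+\psi]\ne F[\phi]$. Let $\mathfrak F$ be the space of formal power series with coefficients in $\mathcal F_{\rm loc}(M)$ in an arbitrary, possibly empty, family of formal parameters; operations and supports extend to $\mathfrak F$ (supports jointly over all coefficients), and $\mathcal F_{\rm loc}(M)\subset\mathfrak F$. Let $\mathcal G_o$ be the group of orthogonal field redefinitions, i.e. of smooth maps $h:M\to \mathrm{SO}(n,\mathbb R)$ with $\mathrm{supp}\,h=\overline{\{x: h(x)\neq 1\}}$ compact. For $A\in\Omega^1_c(M,\mathfrak{so}(n))$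 let $L_A(\phi)=\tfrac12\langle (d+A)\phi,(d+A)\phi\rangle$, $L=L_0$ and $V(A)=\int_M (L_A-L)\,d\mu_{\mathbf g}\in\mathcal F_{\rm loc}(M)$. For $h\in\mathcal G_o$ put $(h_*F)[\phi]=F[h^{-1}\phi]$ and $h_LF=\delta_hL+h_*F$ with $\delta_hL=h_*L(f)-L(f)$ for any test function $f$ with $f=1$ on $\mathrm{supp}\,h$. Let $\mathscr R_c$ be the set of bijections $Z:\mathfrak F\to\mathfrak F$ such that - $Z(F+G+H)=Z(F+G)-Z(G)+Z(G+H)$ if $\mathrm{supp}\,F\cap\mathrm{supp}\,H=\emptyset$; - $Z(F+\langle\Phi,q\rangle)=Z(F)+\langle\Phi,q\rangle$ for all test functions $q\in C_c^\infty(M,\mathbb R^n)$, where $\langle\Phi,q\rangle[\phi]=\int_M q\cdot\phi\,d\mu_{\mathbf g}$; - $Z$ commutes with the shifts $F\mapsto F[\,\cdot+\psi]$, $\psi\in C_c^\infty(M,\mathbb R^n)$; - there is a smallest closed set $N=:\mathrm{supp}\,Z$ such that $Z(F+G)=F+Z(G)$ whenever $\mathrm{supp}\,F\cap N=\emptyset$,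 and it is compact. An anomaly map is a map $\zeta:\mathcal G_o\to\mathscr R_c$ with $\zeta_e=\mathrm{id}$, $\mathrm{supp}\,\zeta_h\subset\mathrm{supp}\,h$ and $\zeta_{gh}=\zeta_h\,h_L^{-1}\zeta_g h_L$ for all $g,h\in\mathcal G_o$. For an anomaly map $\zeta$ put $\mathfrak G(h,A)=\zeta_h(V(A))-V(A)$. **Proposition.** Let $\zeta$ be an anomaly map, $A,\omega,\omega_1,\omega_2\in\Omega^1_c(M,\mathfrak{so}(n))$ and $g,g_1,g_2,h\in\mathcal G_o$. 1. If $\mathrm{supp}\,\omega_1\cap\mathrm{supp}\,\omega_2=\emptyset$, then $\zeta_h(V(A+\omega_1+\omega_2))=\zeta_h(V(A+\omega_1))-\zeta_h(V(A))+\zeta_h(V(A+\omega_2))$. 2. If $\mathrm{supp}\,\omega\cap\mathrm{supp}\,g=\emptyset$, then $\zeta_{gh}(V(A+\omega))=\zeta_h(V(A+\omega))-\zeta_h(V(A))+\zeta_{gh}(V(A))$. 3. If $\mathrm{supp}\,g_1\cap\mathrm{supp}\,g_2=\emptyset$, then $\zeta_{g_1g_2h}(V(A))=\zeta_{g_1h}(V(A))-\zeta_h(V(A))+\zeta_{g_2h}(V(A))$.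 Consequently $\mathfrak G$ is local in the same sense: under the respective hypotheses - $\mathfrak G(h,A+\omega_1+\omega_2)=\mathfrak G(h,A+\omega_1)-\mathfrak G(h,A)+\mathfrak G(h,A+\omega_2)$, - $\mathfrak G(gh,A+\omega)=\mathfrak G(h,A+\omega)-\mathfrak G(h,A)+\mathfrak G(gh,A)$, - $\mathfrak G(g_1g_2h,A)=\mathfrak G(g_1h,A)-\mathfrak G(h,A)+\mathfrak G(g_2h,A)$. -/

import Mathlib

open scoped Manifold ContDiff

namespace PAQFT

noncomputable section

open Set Filter Topology Bundle MeasureTheory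

/-- The model space of a `d`-dimensional manifold. -/
abbrev Coord (d : ℕ) : Type := EuclideanSpace ℝ (Fin d)

section Geometry
variable {d n : ℕ} {M : Type*} [TopologicalSpace M] [ChartedSpace (Coord d) M]

variable (d M) in
/-- Covectors at the point `x`. -/
abbrev Covector (x : M) : Type := TangentSpace (𝓡 d) x →L[ℝ] ℝ

/-- `α` is a smooth 1-form, i.e. a smooth section of the cotangent bundle. -/
def IsSmoothForm [IsManifold (𝓡 d) ∞ M] (α : ∀ x : M, Covector d M x) : Prop :=
  ContMDiff (𝓡 d) ((𝓡 d).prod 𝓘(ℝ, Coord d →L[ℝ] ℝ)) ∞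
    (fun x => TotalSpace.mk' (Coord d →L[ℝ] ℝ) (E := fun x : M => Covector d M x) x (α x))

variable (d M) in
/-- A smooth pseudo-Riemannian metric on `M`: a smooth field of symmetric nondegenerate bilinear
forms on the tangent spaces. Lorentzian metrics, of either sign convention, are the special case
of signature `(1, d - 1)` or `(d - 1, 1)`. -/
structure PseudoMetric [IsManifold (𝓡 d) ∞ M] where
  val : ∀ x : M, TangentSpace (𝓡 d) x →L[ℝ] TangentSpace (𝓡 d) x →L[ℝ] ℝ
  symm : ∀ x v w, val x v w = val x w v
  nondegenerate : ∀ x v, (∀ w, val x v w = 0) → v = 0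
  smooth : ContMDiff (𝓡 d) ((𝓡 d).prod 𝓘(ℝ, Coord d →L[ℝ] Coord d →L[ℝ] ℝ)) ∞
    (fun x => TotalSpace.mk' (Coord d →L[ℝ] Coord d →L[ℝ] ℝ)
      (E := fun x : M => TangentSpace (𝓡 d) x →L[ℝ] TangentSpace (𝓡 d) x →L[ℝ] ℝ) x (val x))

variable [IsManifold (𝓡 d) ∞ M]

namespace PseudoMetric
variable (g : PseudoMetric d M)

/-- The pairing `g⁻¹(α, β)` of covectors induced by the metric: `α` is evaluated on the vector
`β♯` that satisfies `g(β♯, ·) = β`. -/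
def dual (x : M) (α β : Covector d M x) : ℝ := α ((g.val x).inverse β)

instance (x : M) : FiniteDimensional ℝ (TangentSpace (𝓡 d) x) :=
  inferInstanceAs (FiniteDimensional ℝ (Coord d))

instance (x : M) : T2Space (TangentSpace (𝓡 d) x) :=
  inferInstanceAs (T2Space (Coord d))

theorem val_isInvertible (x : M) : (g.val x).IsInvertible := by
  let T := TangentSpace (𝓡 d) x
  have hinj : Function.Injective ((g.val x : T →L[ℝ] Covector d M x) : T →ₗ[ℝ] Covector d M x) := by
    rw [injective_iff_map_eq_zero]
    intro v hv
    apply g.nondegenerate x v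
    intro w
    have : g.val x v = 0 := hv
    simp [this]
  have hfr : Module.finrank ℝ T = Module.finrank ℝ (Covector d M x) := by
    change Module.finrank ℝ (Coord d) = Module.finrank ℝ (Coord d →L[ℝ] ℝ)
    rw [← (LinearMap.toContinuousLinearMap (𝕜 := ℝ) (E := Coord d) (F' := ℝ)).finrank_eq]
    exact (Subspace.dual_finrank_eq (K := ℝ) (V := Coord d)).symm
  have : FiniteDimensional ℝ (Covector d M x) :=
    inferInstanceAs (FiniteDimensional ℝ (Coord d →L[ℝ] ℝ))
  let e := LinearEquiv.ofInjectiveOfFinrankEq _ hinj hfr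
  exact ⟨e.toContinuousLinearEquiv, by ext v; rfl⟩

theorem dual_add_left (x : M) (α β γ : Covector d M x) :
    g.dual x (α + β) γ = g.dual x α γ + g.dual x β γ := rfl

theorem dual_add_right (x : M) (α β γ : Covector d M x) :
    g.dual x α (β + γ) = g.dual x α β + g.dual x α γ := by
  simp [dual]

theorem dual_smul_left (x : M) (c : ℝ) (α β : Covector d M x) :
    g.dual x (c • α) β = c * g.dual x α β := rfl

theorem dual_smul_right (x : M) (c : ℝ) (α β : Covector d M x) :
    g.dual x α (c • β) = c * g.dual x α β := by
  simp [dual]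

theorem inverse_smooth : ContMDiff (𝓡 d) ((𝓡 d).prod 𝓘(ℝ, (Coord d →L[ℝ] ℝ) →L[ℝ] Coord d)) ∞
    (fun x => TotalSpace.mk' ((Coord d →L[ℝ] ℝ) →L[ℝ] Coord d)
      (E := fun x : M => Covector d M x →L[ℝ] TangentSpace (𝓡 d) x) x (g.val x).inverse) := by
  intro x₀
  have h := g.smooth x₀
  rw [contMDiffAt_hom_bundle] at h ⊢
  refine ⟨contMDiffAt_id, ?_⟩
  have h2 := h.2
  have : ContMDiffAt (𝓡 d) 𝓘(ℝ, (Coord d →L[ℝ] ℝ) →L[ℝ] Coord d) ∞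
      (ContinuousLinearMap.inverse ∘ (fun x : M => ContinuousLinearMap.inCoordinates
        (Coord d) (fun x : M => TangentSpace (𝓡 d) x) (Coord d →L[ℝ] ℝ)
          (fun x : M => Covector d M x) x₀ x x₀ x (g.val x))) x₀ := by
    apply ContMDiffAt.comp _ _ h2
    apply ContDiffAt.contMDiffAt
    apply ContinuousLinearMap.IsInvertible.contDiffAt_map_inverse
    rw [ContinuousLinearMap.inCoordinates_eq (FiberBundle.mem_baseSet_trivializationAt' x₀)
      (FiberBundle.mem_baseSet_trivializationAt' x₀)]
    exact ContinuousLinearMap.isInvertible_equiv.comp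
      ((g.val_isInvertible x₀).comp ContinuousLinearMap.isInvertible_equiv)
  refine this.congr_of_eventuallyEq ?_
  filter_upwards [(trivializationAt (Coord d) (fun x : M => TangentSpace (𝓡 d) x)
      x₀).open_baseSet.mem_nhds (FiberBundle.mem_baseSet_trivializationAt' x₀),
    (trivializationAt (Coord d →L[ℝ] ℝ) (fun x : M => Covector d M x)
      x₀).open_baseSet.mem_nhds (FiberBundle.mem_baseSet_trivializationAt' x₀)] with x hx h'x
  simp only [Function.comp_apply]
  rw [ContinuousLinearMap.inCoordinates_eq hx h'x, ContinuousLinearMap.inCoordinates_eq h'x hx]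
  simp only [ContinuousLinearMap.inverse_equiv_comp, ContinuousLinearMap.inverse_comp_equiv,
    ContinuousLinearEquiv.symm_symm]
  rfl

theorem dual_smooth {α β : ∀ x : M, Covector d M x} (hα : IsSmoothForm α) (hβ : IsSmoothForm β) :
    ContMDiff (𝓡 d) 𝓘(ℝ) ∞ (fun x => g.dual x (α x) (β x)) := by
  have h1 := ContMDiff.clm_bundle_apply (E₁ := fun x : M => Covector d M x)
    (E₂ := fun x : M => TangentSpace (𝓡 d) x) g.inverse_smooth hβ
  have h2 := ContMDiff.clm_bundle_apply (E₁ := fun x : M => TangentSpace (𝓡 d) x)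
    (E₂ := Bundle.Trivial M ℝ) hα h1
  intro x
  exact (contMDiffAt_totalSpace.1 (h2 x)).2

end PseudoMetric

/-- The differential `df` of a function. -/
def differential (f : M → ℝ) (x : M) : Covector d M x := mfderiv (𝓡 d) 𝓘(ℝ, ℝ) f x

theorem differential_smooth {f : M → ℝ} (hf : ContMDiff (𝓡 d) 𝓘(ℝ, ℝ) ∞ f) :
    IsSmoothForm (d := d) (differential f) := by
  intro x₀
  rw [contMDiffAt_hom_bundle]
  refine ⟨contMDiffAt_id, ?_⟩
  have := (hf x₀).mfderiv_const (m := ∞) (by simp)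
  refine this.congr_of_eventuallyEq (Eventually.of_forall fun x => ?_)
  simp only [inTangentCoordinates, ContinuousLinearMap.inCoordinates, id, differential]
  ext v
  simp
  rfl

theorem IsSmoothForm.zero : IsSmoothForm fun x : M => (0 : Covector d M x) :=
  contMDiff_zeroSection ℝ _

theorem IsSmoothForm.add {α β : ∀ x : M, Covector d M x} (hα : IsSmoothForm α)
    (hβ : IsSmoothForm β) : IsSmoothForm (fun x => α x + β x) := ContMDiff.add_section hα hβ
theorem IsSmoothForm.smul {f : M → ℝ} {β : ∀ x : M, Covector d M x}
    (hf : ContMDiff (𝓡 d) 𝓘(ℝ) ∞ f)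
    (hβ : IsSmoothForm β) : IsSmoothForm (fun x => f x • β x) := ContMDiff.smul_section hf hβ
theorem IsSmoothForm.sum {ι : Type*} {s : Finset ι} {α : ι → ∀ x : M, Covector d M x} (hα : ∀ i, IsSmoothForm (α i)) : IsSmoothForm (fun x => ∑ i ∈ s, α i x) :=
  ContMDiff.sum_section (fun i _ => hα i)


/-- The coordinate vector `∂_μ` at `x` of the chart around `p` (for `x` in the domain of that
chart): the image of the standard basis vector under the differential of the inverse chart. -/
def coordVec (p : M) (μ : Fin d) (x : M) : TangentSpace (𝓡 d) x :=
  mfderiv 𝓘(ℝ, Coord d) (𝓡 d) (chartAt (Coord d) p).symm (chartAt (Coord d) p x)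
        (EuclideanSpace.single μ (1 : ℝ) : Coord d)

theorem coordVec_eq (p : M) (μ : Fin d) (x : M) (hx : x ∈ (chartAt (Coord d) p).source) :
  coordVec p μ x = (trivializationAt (Coord d) (TangentSpace (𝓡 d)) p).symmL ℝ x (EuclideanSpace.single μ 1) := by
  have := TangentBundle.symmL_trivializationAt (I := 𝓡 d) hx
  rw [this]
  simp [coordVec]
  rfl


variable (d M) in
/-- A smooth partition of unity on `M` such that the function with index `p` is supported in the
domain of the chart around `p`. -/
def chartPartition [T2Space M] [SecondCountableTopology M] :
    SmoothPartitionOfUnity M (𝓡 d) M univ :=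
  haveI : LocallyCompactSpace M := ChartedSpace.locallyCompactSpace (Coord d) M
  (SmoothPartitionOfUnity.exists_isSubordinate_chartAt_source (𝓡 d) M).choose

theorem chartPartition_subordinate [T2Space M] [SecondCountableTopology M] :
   (chartPartition d M).IsSubordinate (fun x => (chartAt (Coord d) x).source) :=
  haveI : LocallyCompactSpace M := ChartedSpace.locallyCompactSpace (Coord d) M
  (SmoothPartitionOfUnity.exists_isSubordinate_chartAt_source (𝓡 d) M).choose_spec

namespace PseudoMetric
variable (g : PseudoMetric d M)

/-- The coordinate volume density `√|det g(∂_μ, ∂_ν)|` at `x` in the chart around `p`. -/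
def volDensity (p x : M) : ℝ :=
  √|(Matrix.of fun μ ν : Fin d => g.val x (coordVec p μ x) (coordVec p ν x)).det|

theorem volDensity_continuousOn (p : M) :
    ContinuousOn (g.volDensity p) (chartAt (Coord d) p).source := by
  have hb : (trivializationAt (Coord d) (TangentSpace (𝓡 d) : M → Type) p).baseSet =
    (chartAt (Coord d) p).source := by simp
  have h0 : ∀ μ : Fin d, ContMDiffOn (𝓡 d) ((𝓡 d).prod 𝓘(ℝ, Coord d)) ∞
      (fun x => TotalSpace.mk' (Coord d) (E := (TangentSpace (𝓡 d) : M → Type))  x (coordVec p μ x)) (chartAt (Coord d) p).source := by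
    intro μ
    have h := (Bundle.Trivialization.contMDiffOn_section_baseSet_iff (IB := 𝓡 d) (n := ∞)
      (s := fun x => coordVec p μ x)
      (trivializationAt (Coord d) (TangentSpace (𝓡 d) : M → Type) p)).2
    rw [hb] at h
    apply h
    refine (contMDiffOn_const (c := (EuclideanSpace.single μ 1 : Coord d))).congr fun x hx => ?_
    rw [coordVec_eq p μ x hx]
    have hx' : x ∈ (trivializationAt (Coord d) (TangentSpace (𝓡 d) : M → Type) p).baseSet := by
      rw [hb]; exact hx
    rw [Bundle.Trivialization.symmL_apply _ hx']
    simp [Bundle.Trivialization.mk_symm _ hx', Bundle.Trivialization.apply_symm_apply' _ hx']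
  have h1 : ∀ μ ν : Fin d, ContinuousOn (fun x => g.val x (coordVec p μ x) (coordVec p ν x)) (chartAt (Coord d) p).source := by
    intro μ ν x hx
    have := ContMDiffWithinAt.clm_bundle_apply₂ (E₁ := (TangentSpace (𝓡 d) : M → Type))
     (E₂ := (TangentSpace (𝓡 d) : M → Type))  (E₃ := Bundle.Trivial M ℝ) (g.smooth.contMDiffOn x hx) (h0 μ x hx) (h0 ν x hx)
    have := (contMDiffWithinAt_totalSpace.1 this).2
    exact this.continuousWithinAt
  unfold volDensity
  refine ContinuousOn.sqrt (ContinuousOn.abs ?_)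
  rw [continuousOn_iff_continuous_domRestrict]
  apply Continuous.matrix_det
  refine continuous_matrix fun μ ν => ?_
  exact continuousOn_iff_continuous_domRestrict.1 (h1 μ ν)


variable [T2Space M] [SecondCountableTopology M]

/-- The integral, in the coordinates of the chart around `p`, of `f` times the corresponding
function of the partition of unity with respect to the volume density of the metric. -/
def chartIntegral (p : M) (f : M → ℝ) : ℝ :=
  ∫ y in (chartAt (Coord d) p).target,
    chartPartition d M p ((chartAt (Coord d) p).symm y) * f ((chartAt (Coord d) p).symm y) *
      g.volDensity p ((chartAt (Coord d) p).symm y)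

/-- The integral `∫_M f dμ_g` of a (continuous compactly supported) function with respect to the
metric volume density, by means of a partition of unity. Smooth densities on `M` are identified
with smooth functions through the metric volume density. -/
def integral (f : M → ℝ) : ℝ := ∑ᶠ p : M, g.chartIntegral p f

theorem chartIntegrable (p : M) {f : M → ℝ} (hf : Continuous f) (hc : HasCompactSupport f) :
    IntegrableOn (fun y => chartPartition d M p ((chartAt (Coord d) p).symm y) *
      f ((chartAt (Coord d) p).symm y) * g.volDensity p ((chartAt (Coord d) p).symm y))
      (chartAt (Coord d) p).target := by
  set c := chartAt (Coord d) p with hcdef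
  set h : M → ℝ := fun x => chartPartition d M p x * f x * g.volDensity p x with hh
  set K : Set M := tsupport (chartPartition d M p) ∩ tsupport f with hK
  have hKc : IsCompact K := hc.isCompact.inter_left (isClosed_tsupport _)
  have hKs : K ⊆ c.source := fun x hx => chartPartition_subordinate p hx.1
  have hcont : ContinuousOn h c.source :=
    (((chartPartition d M p).contMDiff.continuous.mul hf).continuousOn).mul
      (g.volDensity_continuousOn p)
  have hz : ∀ x, x ∉ K → h x = 0 := by
    intro x hx
    by_cases h1 : x ∈ tsupport (chartPartition d M p)
    · have : f x = 0 := image_eq_zero_of_notMem_tsupport fun h2 => hx ⟨h1, h2⟩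
      simp [hh, this]
    · have : chartPartition d M p x = 0 := image_eq_zero_of_notMem_tsupport h1
      simp [hh, this]
  have hK' : IsCompact (c '' K) := hKc.image_of_continuousOn (c.continuousOn.mono hKs)
  have hsub : c '' K ⊆ c.target := by
    rintro _ ⟨x, hx, rfl⟩
    exact c.map_source (hKs hx)
  have hint : IntegrableOn (fun y => h (c.symm y)) (c '' K) := by
    apply ContinuousOn.integrableOn_compact hK'
    exact (hcont.comp c.continuousOn_symm (fun y hy => c.map_target hy)).mono hsub
  refine hint.of_forall_sdiff_eq_zero c.open_target.measurableSet ?_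
  rintro y ⟨hy, hyK⟩
  apply hz
  intro hyK'
  exact hyK ⟨c.symm y, hyK', c.right_inv hy⟩

theorem chartIntegral_support_finite {f : M → ℝ} (hc : HasCompactSupport f) :
    (Function.support fun p => g.chartIntegral p f).Finite := by
  have := (chartPartition d M).locallyFinite.finite_nonempty_inter_compact hc.isCompact
  refine this.subset ?_
  intro p hp
  by_contra hne
  apply hp
  unfold chartIntegral
  refine integral_eq_zero_of_ae (Eventually.of_forall fun y => ?_)
  by_cases h1 : f ((chartAt (Coord d) p).symm y) = 0
  · simp [h1]
  · by_cases h2 : chartPartition d M p ((chartAt (Coord d) p).symm y) = 0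
    · simp [h2]
    · exact absurd ⟨_, h2, subset_tsupport _ h1⟩ hne

theorem integral_add {f h : M → ℝ} (hf : Continuous f) (hcf : HasCompactSupport f)
    (hh : Continuous h) (hch : HasCompactSupport h) :
    g.integral (fun x => f x + h x) = g.integral f + g.integral h := by
  unfold integral
  rw [← finsum_add_distrib (g.chartIntegral_support_finite hcf) (g.chartIntegral_support_finite hch)]
  refine finsum_congr fun p => ?_
  unfold chartIntegral
  rw [← MeasureTheory.integral_add (g.chartIntegrable p hf hcf) (g.chartIntegrable p hh hch)]
  congr 1
  ext y
  ring

theorem integral_smul (r : ℝ) (f : M → ℝ) :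
    g.integral (fun x => r * f x) = r * g.integral f := by
  unfold integral
  rw [← smul_eq_mul, smul_finsum]
  refine finsum_congr fun p => ?_
  unfold chartIntegral
  rw [smul_eq_mul, ← MeasureTheory.integral_const_mul]
  congr 1
  ext y
  ring

end PseudoMetric

end Geometry

section Functionals

variable (d n : ℕ) (M : Type*) [TopologicalSpace M] [ChartedSpace (Coord d) M]

/-- The configuration space `ℰ(M, ℝⁿ)` of smooth functions with values in `ℝⁿ`. -/
abbrev Config : Type _ := C^∞⟮𝓡 d, M; 𝓘(ℝ, Fin n → ℝ), Fin n → ℝ⟯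

/-- Smooth real-valued functions on `M`. -/
abbrev Scalar : Type _ := C^∞⟮𝓡 d, M; 𝓘(ℝ, ℝ), ℝ⟯

variable {d n M}

/-- `φ` and `ψ` have the same jet of order `r` at `x`: in a chart they agree up to terms of order
`r + 1`. -/
def SameJet (r : ℕ) (x : M) (φ ψ : Config d n M) : Prop :=
  (fun y => φ y - ψ y) =O[𝓝 x]
    fun y => ‖chartAt (Coord d) x y - chartAt (Coord d) x x‖ ^ (r + 1)

theorem SameJet.mono {r s : ℕ} (hrs : r ≤ s) {x : M} {φ ψ : Config d n M} (h : SameJet s x φ ψ) :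
    SameJet r x φ ψ := by
  refine h.trans (Asymptotics.IsBigO.of_bound 1 ?_)
  have hc : ContinuousAt (fun y => ‖chartAt (Coord d) x y - chartAt (Coord d) x x‖) x :=
    (((chartAt (Coord d) x).continuousAt (mem_chart_source _ x)).sub continuousAt_const).norm
  have : ∀ᶠ y in 𝓝 x, ‖chartAt (Coord d) x y - chartAt (Coord d) x x‖ < 1 :=
    hc.eventually_lt continuousAt_const (by simp)
  filter_upwards [this] with y hy
  simp only [norm_pow, norm_norm, one_mul]
  exact pow_le_pow_of_le_one (norm_nonneg _) hy.le (by omega)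

theorem SameJet.value {r : ℕ} {x : M} {φ ψ : Config d n M} (h : SameJet r x φ ψ) : φ x = ψ x := by
  have := h.eq_zero_imp.self_of_nhds
  simpa [sub_eq_zero] using this

theorem SameJet.deriv {x : M} {φ ψ : Config d n M} (h : SameJet 1 x φ ψ) (a : Fin n) :
    differential (d := d) (fun y => φ y a) x = differential (fun y => ψ y a) x := by
  have hφ : MDifferentiableAt (𝓡 d) 𝓘(ℝ, ℝ) (fun y => φ y a) x :=
    (contMDiff_pi_space.1 φ.contMDiff a).mdifferentiable (by simp) x
  have hψ : MDifferentiableAt (𝓡 d) 𝓘(ℝ, ℝ) (fun y => ψ y a) x :=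
    (contMDiff_pi_space.1 ψ.contMDiff a).mdifferentiable (by simp) x
  have hD : HasMFDerivAt (𝓡 d) 𝓘(ℝ, ℝ) ((fun y => φ y a) - fun y => ψ y a) x 0 := by
    refine ⟨hφ.continuousAt.sub hψ.continuousAt, ?_⟩
    have hx : ContinuousAt (chartAt (Coord d) x).symm (chartAt (Coord d) x x) :=
      (chartAt (Coord d) x).continuousAt_symm (mem_chart_target _ x)
    have ht : Tendsto (chartAt (Coord d) x).symm (𝓝 (chartAt (Coord d) x x)) (𝓝 x) := by
      simpa [ContinuousAt] using hx
    have h1 := h.comp_tendsto ht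
    have h2 : (fun y => φ ((chartAt (Coord d) x).symm y) a - ψ ((chartAt (Coord d) x).symm y) a)
        =O[𝓝 (chartAt (Coord d) x x)] fun y => ‖y - chartAt (Coord d) x x‖ ^ 2 := by
      refine Asymptotics.IsBigO.trans (Asymptotics.IsBigO.of_bound 1 ?_) (h1.trans
        (Asymptotics.IsBigO.of_bound 1 ?_))
      · refine Eventually.of_forall fun y => ?_
        rw [one_mul]
        exact norm_le_pi_norm (φ ((chartAt (Coord d) x).symm y) -
          ψ ((chartAt (Coord d) x).symm y)) a
      · filter_upwards [(chartAt (Coord d) x).open_target.mem_nhds (mem_chart_target _ x)]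
          with y hy
        simp [(chartAt (Coord d) x).right_inv hy]
    have h3 := (h2.hasFDerivAt (𝕜 := ℝ) (by norm_num)).hasFDerivWithinAt (s := range (𝓡 d))
    exact h3
  have := hD.mfderiv
  have h4 := (hφ.hasMFDerivAt.sub hψ.hasMFDerivAt).mfderiv
  rw [this] at h4
  exact (sub_eq_zero.1 h4.symm)

variable (d n M) in
/-- Polynomial maps from configurations to smooth functions: finite sums of diagonals
`φ ↦ B(φ, …, φ)` of multilinear maps. -/
def polyMaps : Submodule ℝ (Config d n M → Scalar d M) :=
  Submodule.span ℝ {P | ∃ (k : ℕ) (B : MultilinearMap ℝ (fun _ : Fin k => Config d n M)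
    (Scalar d M)), P = fun φ => B fun _ => φ}

theorem polyMaps_comp {P : Config d n M → Scalar d M} (hP : P ∈ polyMaps d n M)
    (T : Config d n M →ₗ[ℝ] Config d n M) : (fun φ => P (T φ)) ∈ polyMaps d n M := by
  induction hP using Submodule.span_induction with
  | mem P h =>
    obtain ⟨k, B, rfl⟩ := h
    exact Submodule.subset_span ⟨k, B.compLinearMap fun _ => T, rfl⟩
  | zero => exact Submodule.zero_mem _
  | add P Q _ _ hP hQ => exact Submodule.add_mem _ hP hQ
  | smul c P _ hP => exact Submodule.smul_mem _ c hP

theorem polyMaps_shift {P : Config d n M → Scalar d M} (hP : P ∈ polyMaps d n M)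
    (ψ : Config d n M) : (fun φ => P (φ + ψ)) ∈ polyMaps d n M := by
  induction hP using Submodule.span_induction with
  | mem P h =>
    obtain ⟨k, B, rfl⟩ := h
    have : (fun φ => B fun _ => φ + ψ) = ∑ s : Finset (Fin k),
        fun φ => B.restr s rfl ψ fun _ => φ := by
      ext1 φ
      have h1 := B.map_add_univ (fun _ => φ) (fun _ => ψ)
      rw [Finset.sum_apply]
      refine Eq.trans h1 (Finset.sum_congr rfl fun s _ => ?_)
      simp only [MultilinearMap.restr, MultilinearMap.coe_mk]
      congr 1
    rw [this]
    exact Submodule.sum_mem _ fun s _ => Submodule.subset_span ⟨_, _, rfl⟩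
  | zero => exact Submodule.zero_mem _
  | add P Q _ _ hP hQ => exact Submodule.add_mem _ hP hQ
  | smul c P _ hP => exact Submodule.smul_mem _ c hP

theorem polyMaps_linear (T : Config d n M →ₗ[ℝ] Scalar d M) : (fun φ => T φ) ∈ polyMaps d n M :=
  Submodule.subset_span ⟨1,
   { toFun := fun v => T (v 0)
     map_update_add' := by
       intro _ v i x y
       obtain rfl : i = 0 := Subsingleton.elim _ _
       simp
     map_update_smul' := by
       intro _ v i c x
       obtain rfl : i = 0 := Subsingleton.elim _ _
       simp }, rfl⟩

theorem polyMaps_bilinear (T : Config d n M →ₗ[ℝ] Config d n M →ₗ[ℝ] Scalar d M) :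
    (fun φ => T φ φ) ∈ polyMaps d n M :=
  Submodule.subset_span ⟨2,
   { toFun := fun v => T (v 0) (v 1)
     map_update_add' := by
       intro _ v i x y
       fin_cases i <;> simp
     map_update_smul' := by
       intro _ v i c x
       fin_cases i <;> simp }, rfl⟩

variable (d n M) in
/-- Local densities `φ ↦ D(φ) = (x ↦ D̂(x, j_x(φ)))`: polynomial maps whose value at `x` depends
only on a jet of finite order of `φ` at `x` and vanishes for `x` outside a fixed compact set.
Since they are polynomial and map smooth functions to smooth functions, these are exactly the
functions `D̂` on a jet bundle that are polynomial along the fibres, smooth, and compactly supported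
in `x`. -/
def localDensities : Submodule ℝ (Config d n M → Scalar d M) where
  carrier := {D | D ∈ polyMaps d n M ∧
    (∃ r : ℕ, ∀ x φ ψ, SameJet r x φ ψ → D φ x = D ψ x) ∧
    (∃ K : Set M, IsCompact K ∧ ∀ φ, ∀ x ∉ K, D φ x = 0)}
  zero_mem' := ⟨Submodule.zero_mem _, ⟨0, fun _ _ _ _ => rfl⟩, ⟨∅, isCompact_empty, fun _ _ _ => rfl⟩⟩
  add_mem' := by
    rintro D E ⟨h1, ⟨r, h2⟩, K, h3, h4⟩ ⟨k1, ⟨s, k2⟩, K', k3, k4⟩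
    refine ⟨Submodule.add_mem _ h1 k1, ⟨max r s, fun x φ ψ h => ?_⟩, K ∪ K', h3.union k3,
      fun φ x hx => ?_⟩
    · change D φ x + E φ x = D ψ x + E ψ x
      rw [h2 x φ ψ (h.mono (le_max_left _ _)), k2 x φ ψ (h.mono (le_max_right _ _))]
    · change D φ x + E φ x = 0
      rw [h4 φ x fun h => hx (Or.inl h), k4 φ x fun h => hx (Or.inr h), add_zero]
  smul_mem' := by
    rintro c D ⟨h1, ⟨r, h2⟩, K, h3, h4⟩
    refine ⟨Submodule.smul_mem _ c h1, ⟨r, fun x φ ψ h => ?_⟩, K, h3, fun φ x hx => ?_⟩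
    · change c * D φ x = c * D ψ x
      rw [h2 x φ ψ h]
    · change c * D φ x = 0
      rw [h4 φ x hx, mul_zero]

theorem localDensities_hasCompactSupport [T2Space M] {D : Config d n M → Scalar d M}
    (hD : D ∈ localDensities d n M) (φ : Config d n M) : HasCompactSupport (D φ) := by
  obtain ⟨-, -, K, hK, h⟩ := hD
  exact HasCompactSupport.intro hK (h φ)

variable [IsManifold (𝓡 d) ∞ M] [T2Space M] [SecondCountableTopology M]

variable (n) in
/-- The space `ℱ_loc(M)` of local functionals `F[φ] = ∫ D̂(x, j_x(φ))`, which are real-valued and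
polynomial in `φ`. -/
def localFunctionals (g : PseudoMetric d M) : Submodule ℝ (Config d n M → ℝ) where
  carrier := {F | ∃ D ∈ localDensities d n M, ∀ φ, F φ = g.integral (D φ)}
  zero_mem' := ⟨0, Submodule.zero_mem _, fun φ => by
    have := g.integral_smul 0 (fun _ => 0)
    simp only [zero_mul] at this
    exact this.symm⟩
  add_mem' := by
    rintro F G ⟨D, hD, hF⟩ ⟨E, hE, hG⟩
    refine ⟨D + E, Submodule.add_mem _ hD hE, fun φ => ?_⟩
    rw [Pi.add_apply, hF, hG]
    exact (g.integral_add (D φ).contMDiff.continuous (localDensities_hasCompactSupport hD φ)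
      (E φ).contMDiff.continuous (localDensities_hasCompactSupport hE φ)).symm
  smul_mem' := by
    rintro c F ⟨D, hD, hF⟩
    refine ⟨c • D, Submodule.smul_mem _ c hD, fun φ => ?_⟩
    rw [Pi.smul_apply, hF]
    exact (g.integral_smul c (D φ)).symm

/-- The support of a functional: `x` does not belong to it if and only if there is a neighbourhood
`U` of `x` such that the functional is insensitive to changes of the configuration inside `U`. -/
def functionalSupport {β : Type*} (F : Config d n M → β) : Set M :=
  {x | ∀ U ∈ 𝓝 x, ∃ φ ψ : Config d n M, tsupport ψ ⊆ U ∧ F (φ + ψ) ≠ F φ}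

end Functionals

section Gauge

variable (d n : ℕ) (M : Type*) [TopologicalSpace M] [ChartedSpace (Coord d) M]

/-- The group `𝒢_o` of orthogonal field redefinitions: smooth compactly supported maps
`M → SO(n, ℝ)` with the pointwise multiplication. -/
def gaugeGroup : Subgroup (M → Matrix.specialOrthogonalGroup (Fin n) ℝ) where
  carrier := {h | (∀ a b : Fin n, ContMDiff (𝓡 d) 𝓘(ℝ, ℝ) ∞ fun x =>
      (h x : Matrix (Fin n) (Fin n) ℝ) a b) ∧ HasCompactMulSupport h}
  one_mem' := ⟨fun a b => contMDiff_const (c := (1 : Matrix (Fin n) (Fin n) ℝ) a b),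
    HasCompactMulSupport.one⟩
  mul_mem' := by
    rintro h k ⟨h1, h2⟩ ⟨k1, k2⟩
    refine ⟨fun a b => ?_, h2.mul k2⟩
    have : (fun x => ((h * k) x : Matrix (Fin n) (Fin n) ℝ) a b) = fun x => ∑ c,
        (h x : Matrix (Fin n) (Fin n) ℝ) a c * (k x : Matrix (Fin n) (Fin n) ℝ) c b := by
      ext x
      exact Matrix.mul_apply
    rw [this]
    exact contMDiff_finsetSum fun c _ => (h1 a c).mul (k1 c b)
  inv_mem' := by
    rintro h ⟨h1, h2⟩
    refine ⟨fun a b => ?_, by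
      change IsCompact (mulTSupport h⁻¹)
      unfold mulTSupport
      rw [Function.mulSupport_inv]
      exact h2⟩
    exact h1 b a

variable {d n M}

theorem gaugeGroup_smooth (h : gaugeGroup d n M) (a b : Fin n) :
    ContMDiff (𝓡 d) 𝓘(ℝ, ℝ) ∞ fun x => (h.1 x : Matrix (Fin n) (Fin n) ℝ) a b := h.2.1 a b

/-- The support of `h : M → SO(n, ℝ)`: the closure of the set where `h` is not the identity. -/
def gaugeSupport (h : gaugeGroup d n M) : Set M := mulTSupport h.1

theorem gaugeSupport_inv (h : gaugeGroup d n M) : gaugeSupport h⁻¹ = gaugeSupport h := by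
  unfold gaugeSupport mulTSupport
  congr 1
  exact Function.mulSupport_inv h.1

/-- The transformation `φ ↦ h φ` of configurations, as column vectors. -/
def rotate (h : gaugeGroup d n M) : Config d n M →ₗ[ℝ] Config d n M where
  toFun φ := ⟨fun x => (h.1 x : Matrix (Fin n) (Fin n) ℝ).mulVec (φ x), by
    rw [contMDiff_pi_space]
    intro a
    have : ∀ b ∈ Finset.univ, ContMDiff (𝓡 d) 𝓘(ℝ, ℝ) ∞ fun x =>
        (h.1 x : Matrix (Fin n) (Fin n) ℝ) a b * φ x b := fun b _ =>
      (gaugeGroup_smooth h a b).mul (contMDiff_pi_space.1 φ.contMDiff b)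
    exact contMDiff_finsetSum this⟩
  map_add' φ ψ := by
    ext x : 1
    exact Matrix.mulVec_add (h.1 x : Matrix (Fin n) (Fin n) ℝ) (φ x) (ψ x)
  map_smul' c φ := by
    ext x : 1
    exact Matrix.mulVec_smul (h.1 x : Matrix (Fin n) (Fin n) ℝ) c (φ x)

theorem rotate_mul (h k : gaugeGroup d n M) (φ : Config d n M) :
    rotate (h * k) φ = rotate h (rotate k φ) := by
  ext x : 1
  exact (Matrix.mulVec_mulVec (φ x) (h.1 x : Matrix (Fin n) (Fin n) ℝ)
    (k.1 x : Matrix (Fin n) (Fin n) ℝ)).symm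

theorem rotate_one (φ : Config d n M) : rotate (1 : gaugeGroup d n M) φ = φ := by
  ext x : 1
  exact Matrix.one_mulVec _

theorem rotate_apply_of_notMem (h : gaugeGroup d n M) (φ : Config d n M) {x : M}
    (hx : x ∉ gaugeSupport h) : rotate h φ x = φ x := by
  have : h.1 x = 1 := image_eq_one_of_notMem_mulTSupport hx
  change (h.1 x : Matrix (Fin n) (Fin n) ℝ).mulVec (φ x) = φ x
  rw [this]
  exact Matrix.one_mulVec _

theorem SameJet.rotate {r : ℕ} {x : M} {φ ψ : Config d n M} (hj : SameJet r x φ ψ)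
    (h : gaugeGroup d n M) : SameJet r x (rotate h φ) (rotate h ψ) := by
  unfold SameJet at hj ⊢
  rw [Asymptotics.isBigO_pi] at hj ⊢
  intro a
  have : (fun y => (PAQFT.rotate h φ y - PAQFT.rotate h ψ y) a) = fun y => ∑ b,
      (h.1 y : Matrix (Fin n) (Fin n) ℝ) a b * ((φ y - ψ y) b) := by
    ext y
    exact congrFun (Matrix.mulVec_sub (h.1 y : Matrix (Fin n) (Fin n) ℝ) (φ y) (ψ y)).symm a
  rw [this]
  refine Asymptotics.IsBigO.fun_sum fun b _ => ?_
  have h1 : (fun y => (h.1 y : Matrix (Fin n) (Fin n) ℝ) a b) =O[𝓝 x] fun _ => (1 : ℝ) :=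
    (gaugeGroup_smooth h a b).continuous.continuousAt.isBigO_one ℝ
  simpa using h1.mul (hj b)

variable (d n M) in
/-- External gauge fields: compactly supported smooth 1-forms with values in `𝔰𝔬(n, ℝ)`, given as
antisymmetric matrices of 1-forms. -/
def gaugeFields [IsManifold (𝓡 d) ∞ M] :
    Submodule ℝ ((x : M) → Fin n → Fin n → Covector d M x) where
  carrier := {A | (∀ a b, IsSmoothForm fun x => A x a b) ∧ (∀ x a b, A x a b = -A x b a) ∧
    IsCompact (closure {x | A x ≠ 0})}
  zero_mem' := ⟨fun _ _ => IsSmoothForm.zero, fun _ _ _ => by simp, by simp⟩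
  add_mem' := by
    rintro A B ⟨h1, h2, h3⟩ ⟨k1, k2, k3⟩
    refine ⟨fun a b => (h1 a b).add (k1 a b), fun x a b => ?_, ?_⟩
    · change A x a b + B x a b = -(A x b a + B x b a)
      rw [h2 x a b, k2 x a b, neg_add]
    · refine (h3.union k3).of_isClosed_subset isClosed_closure ?_
      rw [← closure_union]
      refine closure_mono fun x hx => ?_
      by_contra hne
      simp only [mem_union, mem_ofPred_eq, not_or, not_not] at hne
      exact hx (by rw [Pi.add_apply, hne.1, hne.2, add_zero])
  smul_mem' := by
    rintro c A ⟨h1, h2, h3⟩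
    refine ⟨fun a b => IsSmoothForm.smul contMDiff_const (h1 a b), fun x a b => ?_, ?_⟩
    · change c • A x a b = -(c • A x b a)
      rw [h2 x a b, smul_neg]
    · refine h3.of_isClosed_subset isClosed_closure (closure_mono fun x hx h0 => hx ?_)
      rw [Pi.smul_apply, h0, smul_zero]

variable [IsManifold (𝓡 d) ∞ M]

/-- The support of a gauge field. -/
def gaugeFieldSupport (A : gaugeFields d n M) : Set M := closure {x | A.1 x ≠ 0}

/-- The component `a` of the 1-form `(d + A) φ`. -/
def covDeriv (A : gaugeFields d n M) (φ : Config d n M) (a : Fin n) (x : M) : Covector d M x :=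
  differential (fun y => φ y a) x +
    ∑ b, φ x b • A.1 x a b

theorem covDeriv_smooth (A : gaugeFields d n M) (φ : Config d n M) (a : Fin n) :
    IsSmoothForm (covDeriv A φ a) :=
  (differential_smooth (contMDiff_pi_space.1 φ.contMDiff a)).add
    (IsSmoothForm.sum fun b => IsSmoothForm.smul (contMDiff_pi_space.1 φ.contMDiff b) (A.2.1 a b))

theorem covDeriv_congr (A : gaugeFields d n M) {φ ψ : Config d n M} {x : M} (h : SameJet 1 x φ ψ)
    (a : Fin n) : covDeriv A φ a x = covDeriv A ψ a x := by
  unfold covDeriv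
  rw [h.deriv a, h.value]

theorem covDeriv_add (A : gaugeFields d n M) (φ ψ : Config d n M) (a : Fin n) (x : M) :
    covDeriv A (φ + ψ) a x = covDeriv A φ a x + covDeriv A ψ a x := by
  have hφ : MDifferentiableAt (𝓡 d) 𝓘(ℝ, ℝ) (fun y => φ y a) x :=
    (contMDiff_pi_space.1 φ.contMDiff a).mdifferentiable (by simp) x
  have hψ : MDifferentiableAt (𝓡 d) 𝓘(ℝ, ℝ) (fun y => ψ y a) x :=
    (contMDiff_pi_space.1 ψ.contMDiff a).mdifferentiable (by simp) x
  have h1 : differential (d := d) (fun y => (φ + ψ) y a) x =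
    differential (fun y => φ y a) x + differential (fun y => ψ y a) x :=
    (hφ.hasMFDerivAt.add hψ.hasMFDerivAt).mfderiv
  unfold covDeriv
  rw [h1]
  have h2 : ∑ b, (φ + ψ) x b • A.1 x a b = ∑ b, φ x b • A.1 x a b + ∑ b, ψ x b • A.1 x a b := by
    rw [← Finset.sum_add_distrib]
    exact Finset.sum_congr rfl fun b _ => add_smul _ _ _
  rw [h2]
  exact add_add_add_comm _ _ _ _

theorem covDeriv_smul (A : gaugeFields d n M) (c : ℝ) (φ : Config d n M) (a : Fin n) (x : M) :
    covDeriv A (c • φ) a x = c • covDeriv A φ a x := by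
  have hφ : MDifferentiableAt (𝓡 d) 𝓘(ℝ, ℝ) (fun y => φ y a) x :=
    (contMDiff_pi_space.1 φ.contMDiff a).mdifferentiable (by simp) x
  have h1 : differential (d := d) (fun y => (c • φ) y a) x =
    c • differential (fun y => φ y a) x :=
    (hφ.hasMFDerivAt.const_smul c).mfderiv
  unfold covDeriv
  rw [h1]
  have h2 : ∑ b, (c • φ) x b • A.1 x a b = c • ∑ b, φ x b • A.1 x a b := by
    rw [Finset.smul_sum]
    exact Finset.sum_congr rfl fun b _ => mul_smul _ _ _
  rw [h2]
  exact (smul_add c _ _).symm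

end Gauge
section Lagrangian
variable {d n : ℕ} {M : Type*} [TopologicalSpace M] [ChartedSpace (Coord d) M]
  [IsManifold (𝓡 d) ∞ M] (g : PseudoMetric d M)

/-- The symmetric bilinear form `½ ⟨(d + A) φ, (d + A) ψ⟩`, where the bracket combines the metric
on 1-forms and the canonical inner product of `ℝⁿ`. -/
def lagrangianForm (A : gaugeFields d n M) :
    Config d n M →ₗ[ℝ] Config d n M →ₗ[ℝ] Scalar d M :=
  LinearMap.mk₂ ℝ
    (fun φ ψ => ⟨fun x => (1 / 2 : ℝ) * ∑ a, g.dual x (covDeriv A φ a x) (covDeriv A ψ a x),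
      contMDiff_const.mul (contMDiff_finsetSum fun a _ =>
        g.dual_smooth (covDeriv_smooth A φ a) (covDeriv_smooth A ψ a))⟩)
    (fun φ φ' ψ => by
      ext x
      change (1 / 2 : ℝ) * _ = (1 / 2 : ℝ) * _ + (1 / 2 : ℝ) * _
      simp [covDeriv_add, g.dual_add_left, Finset.sum_add_distrib, mul_add])
    (fun c φ ψ => by
      ext x
      change (1 / 2 : ℝ) * _ = c * ((1 / 2 : ℝ) * _)
      simp only [covDeriv_smul, g.dual_smul_left, ← Finset.mul_sum]
      ring)
    (fun φ ψ ψ' => by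
      ext x
      change (1 / 2 : ℝ) * _ = (1 / 2 : ℝ) * _ + (1 / 2 : ℝ) * _
      simp [covDeriv_add, g.dual_add_right, Finset.sum_add_distrib, mul_add])
    (fun c φ ψ => by
      ext x
      change (1 / 2 : ℝ) * _ = c * ((1 / 2 : ℝ) * _)
      simp only [covDeriv_smul, g.dual_smul_right, ← Finset.mul_sum]
      ring)

/-- The Lagrangian `L_A(φ) = ½ ⟨(d + A) φ, (d + A) φ⟩`. The free Lagrangian `L` is `L_0`. -/
def lagrangian (A : gaugeFields d n M) (φ : Config d n M) : Scalar d M := lagrangianForm g A φ φ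

theorem lagrangian_congr (A : gaugeFields d n M) {φ ψ : Config d n M} {x : M}
    (h : SameJet 1 x φ ψ) : lagrangian g A φ x = lagrangian g A ψ x := by
  change (1 / 2 : ℝ) * _ = (1 / 2 : ℝ) * _
  simp only [covDeriv_congr A h]

theorem lagrangian_eq_free (A : gaugeFields d n M) (φ : Config d n M) {x : M}
    (hx : x ∉ gaugeFieldSupport A) : lagrangian g A φ x = lagrangian g 0 φ x := by
  have h0 : A.1 x = 0 := by
    by_contra h
    exact hx (subset_closure h)
  have : ∀ a, covDeriv A φ a x = covDeriv 0 φ a x := by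
    intro a
    unfold covDeriv
    rw [h0]
    rfl
  change (1 / 2 : ℝ) * _ = (1 / 2 : ℝ) * _
  simp only [this]

theorem lagrangian_rotate_of_notMem (h : gaugeGroup d n M) (φ : Config d n M) {x : M}
    (hx : x ∉ gaugeSupport h) : lagrangian g 0 (rotate h φ) x = lagrangian g 0 φ x := by
  apply lagrangian_congr
  refine Asymptotics.IsBigO.congr' (f₁ := fun _ => 0) (Asymptotics.isBigO_zero _ _) ?_ (EventuallyEq.refl _ _)
  filter_upwards [(isClosed_mulTSupport h.1).isOpen_compl.mem_nhds hx] with y hy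
  rw [rotate_apply_of_notMem h φ hy, sub_self]

variable [T2Space M] [SecondCountableTopology M]

/-- The interaction `V(A) = ∫ (L_A - L)`. -/
def interaction (A : gaugeFields d n M) : localFunctionals n g :=
  ⟨fun φ => g.integral fun x => lagrangian g A φ x - lagrangian g 0 φ x,
    fun φ => lagrangian g A φ - lagrangian g 0 φ,
    ⟨Submodule.sub_mem _ (polyMaps_bilinear (lagrangianForm g A))
      (polyMaps_bilinear (lagrangianForm g 0)),
      ⟨1, fun _ _ _ h => congrArg₂ (· - ·) (lagrangian_congr g A h) (lagrangian_congr g 0 h)⟩,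
      gaugeFieldSupport A, A.2.2.2, fun φ _ hx => sub_eq_zero.2 (lagrangian_eq_free g A φ hx)⟩,
    fun _ => rfl⟩

/-- The variation `δ_h L = h_* L(f) - L(f)` of the free Lagrangian, where `f = 1` on `supp h`.
It does not depend on `f`; here it is written as the integral of the compactly supported density
`L(h⁻¹ φ) - L(φ)`, see `freeVariation_eq_cutoff`. -/
def freeVariation (h : gaugeGroup d n M) : localFunctionals n g :=
  ⟨fun φ => g.integral fun x => lagrangian g 0 (rotate h⁻¹ φ) x - lagrangian g 0 φ x,
    fun φ => lagrangian g 0 (rotate h⁻¹ φ) - lagrangian g 0 φ,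
    ⟨Submodule.sub_mem _ (polyMaps_comp (polyMaps_bilinear (lagrangianForm g 0)) (rotate h⁻¹))
      (polyMaps_bilinear (lagrangianForm g 0)),
      ⟨1, fun _ _ _ hj => congrArg₂ (· - ·) (lagrangian_congr g 0 (hj.rotate _))
        (lagrangian_congr g 0 hj)⟩,
      gaugeSupport h, h.2.2.isCompact, fun φ _ hx => sub_eq_zero.2
        (lagrangian_rotate_of_notMem g h⁻¹ φ (by rwa [gaugeSupport_inv]))⟩,
    fun _ => rfl⟩

variable {g}

/-- The action `(h_* F)[φ] = F[h⁻¹ φ]` on local functionals. -/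
def pushforward (h : gaugeGroup d n M) (F : localFunctionals n g) : localFunctionals n g :=
  ⟨fun φ => F.1 (rotate h⁻¹ φ), by
    obtain ⟨D, ⟨h1, ⟨r, h2⟩, K, h3, h4⟩, h5⟩ := F.2
    exact ⟨fun φ => D (rotate h⁻¹ φ), ⟨polyMaps_comp h1 _, ⟨r, fun x φ ψ hj => h2 x _ _ (hj.rotate _)⟩,
      K, h3, fun φ x hx => h4 _ x hx⟩, fun φ => h5 _⟩⟩

/-- The shifted functional `φ ↦ F[φ + ψ]`. -/
def shift (ψ : Config d n M) (F : localFunctionals n g) : localFunctionals n g :=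
  ⟨fun φ => F.1 (φ + ψ), by
    obtain ⟨D, ⟨h1, ⟨r, h2⟩, K, h3, h4⟩, h5⟩ := F.2
    refine ⟨fun φ => D (φ + ψ), ⟨polyMaps_shift h1 _, ⟨r, fun x φ φ' hj => h2 x _ _ ?_⟩,
      K, h3, fun φ x hx => h4 _ x hx⟩, fun φ => h5 _⟩
    refine Asymptotics.IsBigO.congr_left hj fun y => ?_
    change _ = (φ y + ψ y) - (φ' y + ψ y)
    abel⟩

variable (g) in
/-- The smeared field `⟨Φ, q⟩ : φ ↦ ∫ ∑ₐ qₐ φₐ`. -/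
def smearedField (q : Config d n M) (hq : HasCompactSupport q) : localFunctionals n g :=
  ⟨fun φ => g.integral fun x => ∑ a, q x a * φ x a, by
    let T : Config d n M →ₗ[ℝ] Scalar d M :=
      { toFun := fun φ => ⟨fun x => ∑ a, q x a * φ x a, contMDiff_finsetSum fun a _ =>
          (contMDiff_pi_space.1 q.contMDiff a).mul (contMDiff_pi_space.1 φ.contMDiff a)⟩
        map_add' := fun φ ψ => by
          ext x
          change ∑ a, q x a * (φ x a + ψ x a) = ∑ a, q x a * φ x a + ∑ a, q x a * ψ x a
          simp [mul_add, Finset.sum_add_distrib]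
        map_smul' := fun c φ => by
          ext x
          change ∑ a, q x a * (c * φ x a) = c * ∑ a, q x a * φ x a
          rw [Finset.mul_sum]
          exact Finset.sum_congr rfl fun a _ => by ring }
    refine ⟨fun φ => T φ, ⟨polyMaps_linear T, ⟨0, fun x φ ψ h => ?_⟩, tsupport q, hq.isCompact,
      fun φ x hx => ?_⟩, fun φ => rfl⟩
    · change ∑ a, q x a * φ x a = ∑ a, q x a * ψ x a
      rw [h.value]
    · change ∑ a, q x a * φ x a = 0
      simp [image_eq_zero_of_notMem_tsupport hx]⟩

end Lagrangian

section Anomaly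
variable {d n : ℕ} {M : Type*} [TopologicalSpace M] [ChartedSpace (Coord d) M]
  [IsManifold (𝓡 d) ∞ M] [T2Space M] [SecondCountableTopology M]

theorem PseudoMetric.integral_sub (g : PseudoMetric d M) {f h : M → ℝ} (hf : Continuous f)
    (hcf : HasCompactSupport f) (hh : Continuous h) (hch : HasCompactSupport h) :
    g.integral (fun x => f x - h x) = g.integral f - g.integral h := by
  have h1 := g.integral_add (f := fun x => f x - h x) (hf.sub hh) (hcf.sub hch) hh hch
  simp only [sub_add_cancel] at h1
  rw [h1, add_sub_cancel_right]

theorem freeVariation_eq_cutoff (g : PseudoMetric d M) (h : gaugeGroup d n M) (f : Scalar d M)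
    (hf : HasCompactSupport f) (hf1 : ∀ x ∈ gaugeSupport h, f x = 1) (φ : Config d n M) :
    (freeVariation g h).1 φ = g.integral (fun x => f x * lagrangian g 0 (rotate h⁻¹ φ) x) -
      g.integral fun x => f x * lagrangian g 0 φ x := by
  have hc : ∀ ψ : Config d n M, Continuous fun x => f x * lagrangian g 0 ψ x :=
    fun ψ => f.contMDiff.continuous.mul (lagrangian g 0 ψ).contMDiff.continuous
  refine Eq.trans ?_ (g.integral_sub (hc _) hf.mul_right (hc _) hf.mul_right)
  change g.integral _ = _
  congr 1
  ext x
  by_cases hx : x ∈ gaugeSupport h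
  · rw [hf1 x hx, one_mul, one_mul]
  · rw [lagrangian_rotate_of_notMem g h⁻¹ φ (by rwa [gaugeSupport_inv]), sub_self, sub_self]

theorem freeVariation_hasCompactSupport (g : PseudoMetric d M) (h : gaugeGroup d n M)
    (φ : Config d n M) : HasCompactSupport fun x =>
      lagrangian g 0 (rotate h⁻¹ φ) x - lagrangian g 0 φ x :=
  HasCompactSupport.intro (K := gaugeSupport h) h.2.2.isCompact fun _ hx => sub_eq_zero.2
    (lagrangian_rotate_of_notMem g h⁻¹ φ (by rwa [gaugeSupport_inv]))

theorem freeVariation_mul (g : PseudoMetric d M) (h k : gaugeGroup d n M) :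
    freeVariation g (h * k) = freeVariation g h + pushforward h (freeVariation g k) := by
  ext φ
  have hc : ∀ ψ : Config d n M, Continuous (lagrangian g 0 ψ) :=
    fun ψ => (lagrangian g 0 ψ).contMDiff.continuous
  change _ = g.integral _ + g.integral _
  refine Eq.trans ?_ (g.integral_add ((hc _).sub (hc _)) (freeVariation_hasCompactSupport g h φ)
    ((hc _).sub (hc _)) (freeVariation_hasCompactSupport g k (rotate h⁻¹ φ)))
  change g.integral _ = _
  congr 1
  ext x
  rw [mul_inv_rev, rotate_mul]
  ring

theorem freeVariation_one (g : PseudoMetric d M) :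
    freeVariation g (1 : gaugeGroup d n M) = 0 := by
  ext φ
  have h0 := g.integral_smul 0 (fun _ => 0)
  simp only [zero_mul] at h0
  change g.integral _ = 0
  rw [← h0]
  congr 1
  ext x
  rw [inv_one, rotate_one, sub_self]

variable (n) in
/-- Formal power series, in formal parameters indexed by `σ`, with coefficients in `ℱ_loc(M)`. For
empty `σ` this is `ℱ_loc(M)` itself. -/
abbrev FormalFunctionals (g : PseudoMetric d M) (σ : Type*) : Type _ :=
  (σ →₀ ℕ) → localFunctionals n g

variable {g : PseudoMetric d M} {σ : Type*}

/-- A local functional as a constant formal power series. -/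
def FormalFunctionals.ofLocal (σ : Type*) (F : localFunctionals n g) : FormalFunctionals n g σ :=
  letI : DecidableEq (σ →₀ ℕ) := Classical.decEq _
  Pi.single 0 F

/-- The support of a formal power series of local functionals. -/
def FormalFunctionals.support (F : FormalFunctionals n g σ) : Set M :=
  functionalSupport fun (φ : Config d n M) (k : σ →₀ ℕ) => (F k).1 φ

/-- The action `h_L F = δ_h L + h_* F`. -/
def gaugeAction (h : gaugeGroup d n M) (F : FormalFunctionals n g σ) : FormalFunctionals n g σ :=
  FormalFunctionals.ofLocal σ (freeVariation g h) + fun k => pushforward h (F k)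

theorem gaugeAction_mul (h k : gaugeGroup d n M) (F : FormalFunctionals n g σ) :
    gaugeAction (h * k) F = gaugeAction h (gaugeAction k F) := by
  letI : DecidableEq (σ →₀ ℕ) := Classical.decEq _
  funext m
  have hp : ∀ G : localFunctionals n g,
      pushforward (h * k) G = pushforward h (pushforward k G) := by
    intro G
    ext φ
    change G.1 (rotate (h * k)⁻¹ φ) = G.1 (rotate k⁻¹ (rotate h⁻¹ φ))
    rw [mul_inv_rev, rotate_mul]
  have ha : ∀ G H : localFunctionals n g,
      pushforward h (G + H) = pushforward h G + pushforward h H := fun _ _ => rfl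
  simp only [gaugeAction, FormalFunctionals.ofLocal, Pi.add_apply, hp, ha]
  by_cases hm : m = 0
  · subst hm
    simp only [Pi.single_eq_same, freeVariation_mul]
    abel
  · simp only [Pi.single_eq_of_ne hm]
    change _ = 0 + (0 + _)
    simp

theorem gaugeAction_one (F : FormalFunctionals n g σ) :
    gaugeAction (1 : gaugeGroup d n M) F = F := by
  funext m
  have hp : ∀ G : localFunctionals n g, pushforward (1 : gaugeGroup d n M) G = G := by
    intro G
    ext φ
    change G.1 (rotate 1⁻¹ φ) = G.1 φ
    rw [inv_one, rotate_one]
  simp [gaugeAction, FormalFunctionals.ofLocal, freeVariation_one, hp]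

/-- The map `h_L` as a bijection. -/
def gaugePerm (h : gaugeGroup d n M) : Equiv.Perm (FormalFunctionals n g σ) where
  toFun := gaugeAction h
  invFun := gaugeAction h⁻¹
  left_inv F := by rw [← gaugeAction_mul, inv_mul_cancel, gaugeAction_one]
  right_inv F := by rw [← gaugeAction_mul, mul_inv_cancel, gaugeAction_one]

/-- `N` is the support of `Z`: the smallest closed subset of `M` such that `Z(F + G) = F + Z(G)`
whenever `supp F ∩ N = ∅`. -/
def IsRenormalizationSupport (Z : Equiv.Perm (FormalFunctionals n g σ)) (N : Set M) : Prop :=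
  IsLeast {N : Set M | IsClosed N ∧ ∀ F G : FormalFunctionals n g σ,
    Disjoint F.support N → Z (F + G) = F + Z G} N

/-- `Z` is a renormalization group map with compact support: an invertible map of local
functionals that satisfies locality (additivity), is compatible with the field equation,
`Z(F + ⟨Φ, q⟩) = Z(F) + ⟨Φ, q⟩`, commutes with shifts of the field (field independence), and has
compact support. -/
structure IsRenormalizationMap (Z : Equiv.Perm (FormalFunctionals n g σ)) : Prop where
  additive : ∀ F G H : FormalFunctionals n g σ, Disjoint F.support H.support →
    Z (F + G + H) = Z (F + G) - Z G + Z (G + H)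
  field_equation : ∀ (F : FormalFunctionals n g σ) (q : Config d n M) (hq : HasCompactSupport q),
    Z (F + .ofLocal σ (smearedField g q hq)) = Z F + .ofLocal σ (smearedField g q hq)
  field_independence : ∀ (F : FormalFunctionals n g σ) (ψ : Config d n M), HasCompactSupport ψ →
    Z (fun k => shift ψ (F k)) = fun k => shift ψ (Z F k)
  compact_support : ∃ N : Set M, IsCompact N ∧ IsRenormalizationSupport Z N

/-- `ζ` is an anomaly map on the orthogonal field redefinitions: it takes values in the
compactly supported renormalization group maps, `ζ_e = id`, `supp ζ_h ⊆ supp h`, and it satisfies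
the cocycle relation `ζ_{hk} = ζ_k k_L⁻¹ ζ_h k_L`. -/
structure IsAnomalyMap (ζ : gaugeGroup d n M → Equiv.Perm (FormalFunctionals n g σ)) : Prop where
  renormalization : ∀ h, IsRenormalizationMap (ζ h)
  one : ζ 1 = 1
  support : ∀ h N, IsRenormalizationSupport (ζ h) N → N ⊆ gaugeSupport h
  cocycle : ∀ h k, ζ (h * k) = ζ k * (gaugePerm k)⁻¹ * ζ h * gaugePerm k

/-- The group-level anomaly `𝔊(h, A) = ζ_h(V(A)) - V(A)`. -/
def anomaly (ζ : gaugeGroup d n M → Equiv.Perm (FormalFunctionals n g σ))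
    (h : gaugeGroup d n M) (A : gaugeFields d n M) : FormalFunctionals n g σ :=
  ζ h (.ofLocal σ (interaction g A)) - .ofLocal σ (interaction g A)

end Anomaly

end

end PAQFT

open PAQFT

namespace PAQFT

noncomputable section

open Set Filter Topology

/-! ### Configurations that agree near a point. -/

section Local

variable {d n : ℕ} {M : Type*} [TopologicalSpace M] [ChartedSpace (Coord d) M]

/-! The map `h_L` is affine with linear part `h_*`, so the cocycle relation takes the form ζ_{kh}(Y)
= ζ_h(Y + C) with the correction C = h⁻¹_*(ζ_k(h_L Y) - h_L Y) (`IsAnomalyMap.mul_apply`).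
Everything rests on C living over supp k. To see this, let Z be a renormalization map with support
N, and let ψ have compact support off N. The shift of P by ψ differs from P by a functional
supported in supp ψ, which Z passes through unchanged. As Z commutes with shifts, Z(P) - P is
invariant under the shift by ψ (`IsRenormalizationSupport.sub_insensitive`). The linear map h⁻¹_*
acts pointwise on the field and preserves this localization.

Put F_i = V(A + ω_i) - V(A), a functional over supp ω_i. For disjoint supp ω_1 and supp ω_2 the
Lagrangian density gives V(A + ω_1 + ω_2) = V(A) + F_1 + F_2, and the first claim is additivity of
ζ_h. For the second, with F = V(A + ω) - V(A), the functional h_*F lies away from supp g. Hence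
replacing Y = V(A) by Y + F does not alter the correction of g, and additivity of ζ_h separates F
from that correction. For the third, ζ_{g_1 g_2}(P) - P is the sum of the two individual differences
(`IsAnomalyMap.mul_apply_of_disjoint`), so C splits into parts over supp g_1 and supp g_2, and
additivity applies again.

Localization is tracked by `FormalFunctionals.Insensitive` rather than by
`FormalFunctionals.support`. It is a global statement about shifts, stable under sums and h_*, it
gives h_*F = F directly when h is the identity off a set disjoint from K, and for closed K it bounds
the support. -/

theorem SameJet.of_eventuallyEq {x : M} {φ ψ : Config d n M} (h : φ =ᶠ[𝓝 x] ψ) (r : ℕ) :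
    SameJet r x φ ψ := by
  refine Asymptotics.IsBigO.congr' (f₁ := fun _ => 0) (Asymptotics.isBigO_zero _ _) ?_
    (EventuallyEq.refl _ _)
  filter_upwards [h] with y hy
  rw [hy, sub_self]

theorem SameJet.add_of_notMem_tsupport {x : M} (φ : Config d n M) {ψ : Config d n M}
    (h : x ∉ tsupport ψ) (r : ℕ) : SameJet r x (φ + ψ) φ := by
  refine .of_eventuallyEq ?_ r
  filter_upwards [notMem_tsupport_iff_eventuallyEq.1 h] with y hy
  change φ y + ψ y = φ y
  rw [hy]
  exact add_zero _

theorem SameJet.rotate_of_notMem {x : M} {h : gaugeGroup d n M} (hx : x ∉ gaugeSupport h)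
    (φ : Config d n M) (r : ℕ) : SameJet r x (PAQFT.rotate h φ) φ := by
  refine .of_eventuallyEq ?_ r
  filter_upwards [(isClosed_mulTSupport h.1).isOpen_compl.mem_nhds hx] with y hy
  exact rotate_apply_of_notMem h φ hy

theorem tsupport_rotate_subset (h : gaugeGroup d n M) (ψ : Config d n M) :
    tsupport (rotate h ψ) ⊆ tsupport ψ := by
  refine closure_mono fun x hx h0 => hx ?_
  change (h.1 x : Matrix (Fin n) (Fin n) ℝ).mulVec (ψ x) = 0
  rw [h0, Matrix.mulVec_zero]

end Local

/-! ### Functionals localized over a set, under shifts and field redefinitions. -/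

variable {d n : ℕ} {M : Type*} [TopologicalSpace M] [ChartedSpace (Coord d) M]
  [IsManifold (𝓡 d) ∞ M] [T2Space M] [SecondCountableTopology M]
  {g : PseudoMetric d M} {σ : Type*}

/-- `F` does not change under compactly supported shifts of the field away from `K`. -/
def FormalFunctionals.Insensitive (F : FormalFunctionals n g σ) (K : Set M) : Prop :=
  ∀ φ ψ : Config d n M, HasCompactSupport ψ → Disjoint (tsupport ψ) K →
    ∀ k, (F k).1 (φ + ψ) = (F k).1 φ

theorem FormalFunctionals.Insensitive.mono {F : FormalFunctionals n g σ} {K K' : Set M}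
    (h : F.Insensitive K) (hK : K ⊆ K') : F.Insensitive K' :=
  fun φ ψ hc hd k => h φ ψ hc (hd.mono_right hK) k

theorem FormalFunctionals.Insensitive.add {F G : FormalFunctionals n g σ} {K : Set M}
    (hF : F.Insensitive K) (hG : G.Insensitive K) : (F + G).Insensitive K :=
  fun φ ψ hc hd k => congrArg₂ (· + ·) (hF φ ψ hc hd k) (hG φ ψ hc hd k)

/-- A point off K has a compact neighbourhood missing K, and every ψ supported in it is an
admissible shift. Compactness is needed because the support tests arbitrary ψ, whereas insensitivity
only concerns compactly supported ones. -/
theorem FormalFunctionals.Insensitive.support_subset {F : FormalFunctionals n g σ} {K : Set M}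
    (h : F.Insensitive K) (hK : IsClosed K) : F.support ⊆ K := by
  have : LocallyCompactSpace M := ChartedSpace.locallyCompactSpace (Coord d) M
  intro x hx
  by_contra hxK
  obtain ⟨U, hU, hUK, hUc⟩ := local_compact_nhds (hK.isOpen_compl.mem_nhds hxK)
  obtain ⟨φ, ψ, hψ, hne⟩ := hx U hU
  refine hne (funext fun k => h φ ψ (hUc.of_isClosed_subset (isClosed_tsupport _) hψ) ?_ k)
  exact disjoint_left.2 fun y hy => hUK (hψ hy)

/-- The integrands at φ + ψ and φ agree pointwise: off K both vanish, and near a point of K the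
shift ψ is zero, so the jets coincide there. -/
theorem insensitive_of_density {F : FormalFunctionals n g σ} {K : Set M}
    (h : ∀ k, ∃ D : Config d n M → Scalar d M, ∃ r : ℕ,
      (∀ x φ ψ, SameJet r x φ ψ → D φ x = D ψ x) ∧ (∀ φ, ∀ x ∉ K, D φ x = 0) ∧
      ∀ φ, (F k).1 φ = g.integral (D φ)) : F.Insensitive K := by
  intro φ ψ _ hd k
  obtain ⟨D, r, hr, hK, hF⟩ := h k
  rw [hF, hF]
  congr 1
  ext x
  by_cases hx : x ∈ K
  · exact hr x _ _ (.add_of_notMem_tsupport φ (fun h' => disjoint_left.1 hd h' hx) r)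
  · rw [hK _ x hx, hK _ x hx]

theorem FormalFunctionals.ofLocal_add (F G : localFunctionals n g) :
    ofLocal σ (F + G) = ofLocal σ F + ofLocal σ G := by
  let _ : DecidableEq (σ →₀ ℕ) := Classical.decEq _
  exact Pi.single_add (f := fun _ : σ →₀ ℕ => localFunctionals n g) 0 F G

theorem FormalFunctionals.ofLocal_sub (F G : localFunctionals n g) :
    ofLocal σ (F - G) = ofLocal σ F - ofLocal σ G := by
  let _ : DecidableEq (σ →₀ ℕ) := Classical.decEq _
  exact Pi.single_sub (f := fun _ : σ →₀ ℕ => localFunctionals n g) 0 F G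

theorem ofLocal_insensitive {F : localFunctionals n g} {K : Set M}
    {D : Config d n M → Scalar d M} {r : ℕ}
    (hr : ∀ x φ ψ, SameJet r x φ ψ → D φ x = D ψ x) (hK : ∀ φ, ∀ x ∉ K, D φ x = 0)
    (hF : ∀ φ, F.1 φ = g.integral (D φ)) : (FormalFunctionals.ofLocal σ F).Insensitive K := by
  let _ : DecidableEq (σ →₀ ℕ) := Classical.decEq _
  intro φ ψ hc hd k
  by_cases hk : k = 0
  · subst hk
    have h1 : (FormalFunctionals.ofLocal σ F) 0 = F :=
      Pi.single_eq_same (M := fun _ : σ →₀ ℕ => localFunctionals n g) 0 F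
    rw [h1]
    exact insensitive_of_density (F := fun _ : σ →₀ ℕ => F) (fun _ => ⟨D, r, hr, hK, hF⟩)
      φ ψ hc hd 0
  · have h1 : (FormalFunctionals.ofLocal σ F) k = 0 :=
      Pi.single_eq_of_ne (M := fun _ : σ →₀ ℕ => localFunctionals n g) hk F
    rw [h1]
    rfl

theorem localFunctional_sub_eq_integral {D E : Config d n M → Scalar d M}
    {F G : localFunctionals n g} (hF : ∀ φ, F.1 φ = g.integral (D φ))
    (hG : ∀ φ, G.1 φ = g.integral (E φ)) (hD : ∀ φ, HasCompactSupport (D φ))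
    (hE : ∀ φ, HasCompactSupport (E φ)) (φ : Config d n M) :
    (F - G).1 φ = g.integral (D φ - E φ : Scalar d M) := by
  change F.1 φ - G.1 φ = _
  rw [hF, hG]
  exact (g.integral_sub (D φ).contMDiff.continuous (hD φ) (E φ).contMDiff.continuous (hE φ)).symm

/-- Off supp ψ the jets of φ + ψ and φ coincide, so the density of the difference vanishes there.
This links field independence to the support condition of a renormalization map. -/
theorem shift_sub_insensitive (F : FormalFunctionals n g σ) (ψ : Config d n M) :
    FormalFunctionals.Insensitive ((fun k => shift ψ (F k)) - F) (tsupport ψ) := by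
  refine insensitive_of_density fun k => ?_
  obtain ⟨D, hD, hF⟩ := (F k).2
  obtain ⟨r, hr⟩ := hD.2.1
  refine ⟨fun φ => D (φ + ψ) - D φ, r, fun x φ φ' hj => ?_, fun φ x hx => ?_, ?_⟩
  · refine congrArg₂ (· - ·) (hr x _ _ ?_) (hr x _ _ hj)
    refine Asymptotics.IsBigO.congr_left hj fun y => ?_
    change _ = (φ y + ψ y) - (φ' y + ψ y)
    abel
  · exact sub_eq_zero.2 (hr x _ _ (.add_of_notMem_tsupport φ hx r))
  · exact localFunctional_sub_eq_integral (F := shift ψ (F k)) (fun φ => hF (φ + ψ)) hF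
      (fun φ => localDensities_hasCompactSupport hD _)
      (fun φ => localDensities_hasCompactSupport hD _)

/-- The coefficientwise action `h_*` on formal power series. -/
def formalPushforward (h : gaugeGroup d n M) (F : FormalFunctionals n g σ) :
    FormalFunctionals n g σ := fun k => pushforward h (F k)

/-- This is the affinity of `h_L`: the inhomogeneous term δ_h L enters only once. -/
theorem gaugeAction_add (h : gaugeGroup d n M) (F G : FormalFunctionals n g σ) :
    gaugeAction h (F + G) = gaugeAction h F + formalPushforward h G :=
  (add_assoc (FormalFunctionals.ofLocal σ (freeVariation g h)) (formalPushforward h F)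
    (formalPushforward h G)).symm

/-- Since h⁻¹ acts linearly and pointwise, it turns a shift by ψ into the shift by h⁻¹ψ, whose
support is no larger. -/
theorem FormalFunctionals.Insensitive.formalPushforward {F : FormalFunctionals n g σ} {K : Set M}
    (hF : F.Insensitive K) (h : gaugeGroup d n M) :
    (formalPushforward h F).Insensitive K := by
  intro φ ψ hc hd k
  change (F k).1 (rotate h⁻¹ (φ + ψ)) = (F k).1 (rotate h⁻¹ φ)
  rw [map_add]
  have hs := tsupport_rotate_subset h⁻¹ ψ
  exact hF _ _ (hc.isCompact.of_isClosed_subset (isClosed_tsupport _) hs) (hd.mono_left hs) k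

/-- The field h⁻¹φ is φ shifted by h⁻¹φ - φ, which has compact support inside supp h and hence away
from K. -/
theorem FormalFunctionals.Insensitive.formalPushforward_eq {F : FormalFunctionals n g σ}
    {K : Set M} (hF : F.Insensitive K) {h : gaugeGroup d n M} (hd : Disjoint K (gaugeSupport h)) :
    PAQFT.formalPushforward h F = F := by
  funext k
  ext φ
  change (F k).1 (rotate h⁻¹ φ) = (F k).1 φ
  have hs : tsupport (rotate h⁻¹ φ - φ : Config d n M) ⊆ gaugeSupport h := by
    refine closure_minimal (fun x hx => ?_) (isClosed_mulTSupport h.1)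
    by_contra hn
    exact hx (sub_eq_zero.2 (rotate_apply_of_notMem h⁻¹ φ (by rwa [gaugeSupport_inv])))
  have := hF φ (rotate h⁻¹ φ - φ) (h.2.2.isCompact.of_isClosed_subset (isClosed_tsupport _) hs)
    (hd.symm.mono_left hs) k
  rwa [add_sub_cancel] at this

/-- Off supp h the redefinition is the identity near each point, so it preserves jets; the densities
of h_*F - F and of δ_h L both vanish there. -/
theorem gaugeAction_sub_insensitive (h : gaugeGroup d n M) (F : FormalFunctionals n g σ) :
    (gaugeAction h F - F).Insensitive (gaugeSupport h) := by
  have h1 : (formalPushforward h F - F).Insensitive (gaugeSupport h) := by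
    refine insensitive_of_density fun k => ?_
    obtain ⟨D, hD, hF⟩ := (F k).2
    obtain ⟨r, hr⟩ := hD.2.1
    refine ⟨fun φ => D (rotate h⁻¹ φ) - D φ, r, fun x φ φ' hj => ?_, fun φ x hx => ?_, ?_⟩
    · exact congrArg₂ (· - ·) (hr x _ _ (hj.rotate _)) (hr x _ _ hj)
    · exact sub_eq_zero.2 (hr x _ _ (.rotate_of_notMem (by rwa [gaugeSupport_inv]) φ r))
    · exact localFunctional_sub_eq_integral (F := pushforward h (F k)) (fun φ => hF _) hF
        (fun φ => localDensities_hasCompactSupport hD _)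
        (fun φ => localDensities_hasCompactSupport hD _)
  have h2 : (FormalFunctionals.ofLocal σ (freeVariation g h)).Insensitive (gaugeSupport h) :=
    ofLocal_insensitive (D := fun φ => lagrangian g 0 (rotate h⁻¹ φ) - lagrangian g 0 φ) (r := 1)
      (fun _ _ _ hj => congrArg₂ (· - ·) (lagrangian_congr g 0 (hj.rotate _))
        (lagrangian_congr g 0 hj))
      (fun φ _ hx => sub_eq_zero.2
        (lagrangian_rotate_of_notMem g h⁻¹ φ (by rwa [gaugeSupport_inv])))
      (fun _ => rfl)
  have h3 : gaugeAction h F - F = FormalFunctionals.ofLocal σ (freeVariation g h) +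
      (formalPushforward h F - F) := add_sub_assoc _ _ _
  rw [h3]
  exact h2.add h1

/-! ### Locality of the interaction in the gauge field. -/

section Interaction

theorem lagrangian_congr_field {A B : gaugeFields d n M} {x : M} (h : A.1 x = B.1 x)
    (φ : Config d n M) : lagrangian g A φ x = lagrangian g B φ x := by
  have : ∀ a, covDeriv A φ a x = covDeriv B φ a x := fun a => by
    unfold covDeriv
    rw [h]
  change (1 / 2 : ℝ) * _ = (1 / 2 : ℝ) * _
  simp only [this]

theorem gaugeFields_add_apply_of_notMem (A : gaugeFields d n M) {a : gaugeFields d n M} {x : M}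
    (hx : x ∉ gaugeFieldSupport a) : (A + a).1 x = A.1 x := by
  have h0 : a.1 x = 0 := by
    by_contra h
    exact hx (subset_closure h)
  change A.1 x + a.1 x = A.1 x
  rw [h0, add_zero]

theorem interaction_density_hasCompactSupport (g : PseudoMetric d M) (A : gaugeFields d n M)
    (φ : Config d n M) :
    HasCompactSupport (lagrangian g A φ - lagrangian g 0 φ : Scalar d M) :=
  HasCompactSupport.intro (K := gaugeFieldSupport A) A.2.2.2 fun _ hx => sub_eq_zero.2
    (lagrangian_eq_free g A φ hx)

/-- The free Lagrangian cancels, which leaves a single integral whose density can be compared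
pointwise. -/
theorem interaction_sub (A B : gaugeFields d n M) (φ : Config d n M) :
    (interaction g A - interaction g B).1 φ =
      g.integral (lagrangian g A φ - lagrangian g B φ : Scalar d M) := by
  rw [localFunctional_sub_eq_integral (fun _ => rfl) (fun _ => rfl)
    (D := fun φ => lagrangian g A φ - lagrangian g 0 φ)
    (E := fun φ => lagrangian g B φ - lagrangian g 0 φ)
    (interaction_density_hasCompactSupport g A) (interaction_density_hasCompactSupport g B),
    sub_sub_sub_cancel_right]

theorem interaction_add_sub_insensitive (A a : gaugeFields d n M) :
    (FormalFunctionals.ofLocal σ (interaction g (A + a)) -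
      FormalFunctionals.ofLocal σ (interaction g A)).Insensitive (gaugeFieldSupport a) := by
  rw [← FormalFunctionals.ofLocal_sub]
  exact ofLocal_insensitive (D := fun φ => lagrangian g (A + a) φ - lagrangian g A φ) (r := 1)
    (fun _ _ _ h => congrArg₂ (· - ·) (lagrangian_congr g _ h) (lagrangian_congr g _ h))
    (fun φ x hx => sub_eq_zero.2
      (lagrangian_congr_field (gaugeFields_add_apply_of_notMem A hx) φ))
    (interaction_sub _ _)

theorem interaction_local (A a₁ a₂ : gaugeFields d n M)
    (hd : Disjoint (gaugeFieldSupport a₁) (gaugeFieldSupport a₂)) :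
    interaction g (A + a₁ + a₂) =
      interaction g (A + a₁) - interaction g A + interaction g (A + a₂) := by
  -- With V(A + a₂) moved to the left, each side is a difference of two interactions, hence one
  -- integral. At each point at least one of a₁, a₂ vanishes, so the densities agree.
  rw [← sub_eq_iff_eq_add]
  ext φ
  rw [interaction_sub, interaction_sub]
  congr 1
  ext x
  change lagrangian g _ φ x - lagrangian g _ φ x = lagrangian g _ φ x - lagrangian g _ φ x
  by_cases hx : x ∈ gaugeFieldSupport a₁
  · have hx₂ := disjoint_left.1 hd hx
    rw [lagrangian_congr_field (gaugeFields_add_apply_of_notMem (A + a₁) hx₂) φ,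
      lagrangian_congr_field (gaugeFields_add_apply_of_notMem A hx₂) φ]
  · rw [add_right_comm, lagrangian_congr_field (gaugeFields_add_apply_of_notMem (A + a₂) hx) φ,
      lagrangian_congr_field (gaugeFields_add_apply_of_notMem A hx) φ, sub_self, sub_self]

end Interaction

/-! ### Locality of renormalization maps and of the cocycle. -/

section Renormalization

/-- Write P_ψ for P shifted by ψ. Then Z(P_ψ) = (P_ψ - P) + Z(P) by the support condition and Z(P_ψ)
= Z(P)_ψ by field independence; comparing the two gives Z(P)_ψ - P_ψ = Z(P) - P. -/
theorem IsRenormalizationSupport.sub_insensitive {Z : Equiv.Perm (FormalFunctionals n g σ)}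
    {N : Set M} (hZ : IsRenormalizationMap Z) (hN : IsRenormalizationSupport Z N)
    (P : FormalFunctionals n g σ) : (Z P - P).Insensitive N := by
  intro φ ψ hc hd k
  have h1 := hZ.field_independence P ψ hc
  have h2 := hN.1.2 ((fun k => shift ψ (P k)) - P) P
    (hd.mono_left ((shift_sub_insensitive P ψ).support_subset (isClosed_tsupport _)))
  rw [sub_add_cancel, h1] at h2
  have h3 : (Z P k).1 (φ + ψ) = (P k).1 (φ + ψ) - (P k).1 φ + (Z P k).1 φ :=
    congrArg (fun F : FormalFunctionals n g σ => (F k).1 φ) h2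
  change (Z P k).1 (φ + ψ) - (P k).1 (φ + ψ) = (Z P k).1 φ - (P k).1 φ
  rw [h3]
  ring

variable {ζ : gaugeGroup d n M → Equiv.Perm (FormalFunctionals n g σ)}

theorem IsAnomalyMap.sub_insensitive (hζ : IsAnomalyMap ζ) (h : gaugeGroup d n M)
    (P : FormalFunctionals n g σ) : (ζ h P - P).Insensitive (gaugeSupport h) := by
  obtain ⟨N, -, hN⟩ := (hζ.renormalization h).compact_support
  exact (hN.sub_insensitive (hζ.renormalization h) P).mono (hζ.support h N hN)

theorem IsAnomalyMap.apply_add (hζ : IsAnomalyMap ζ) {h : gaugeGroup d n M}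
    {F : FormalFunctionals n g σ} {K : Set M} (hK : IsClosed K) (hF : F.Insensitive K)
    (hd : Disjoint K (gaugeSupport h)) (G : FormalFunctionals n g σ) :
    ζ h (G + F) = ζ h G + F := by
  obtain ⟨N, -, hN⟩ := (hζ.renormalization h).compact_support
  rw [add_comm, hN.1.2 F G (hd.mono (hF.support_subset hK) (hζ.support h N hN)), add_comm]

theorem IsAnomalyMap.apply_add_add (hζ : IsAnomalyMap ζ) (h : gaugeGroup d n M)
    {F H : FormalFunctionals n g σ} {K K' : Set M} (hK : IsClosed K) (hK' : IsClosed K')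
    (hF : F.Insensitive K) (hH : H.Insensitive K') (hd : Disjoint K K')
    (G : FormalFunctionals n g σ) :
    ζ h (G + F + H) = ζ h (G + F) - ζ h G + ζ h (G + H) := by
  rw [add_comm G F]
  exact (hζ.renormalization h).additive F G H
    (hd.mono (hF.support_subset hK) (hH.support_subset hK'))

/-- `ζ_{kh}(Y) = ζ_h(Y + h⁻¹_* (ζ_k(h_L Y) - h_L Y))`, by the cocycle relation. -/
theorem IsAnomalyMap.mul_apply (hζ : IsAnomalyMap ζ) (k h : gaugeGroup d n M)
    (Y : FormalFunctionals n g σ) :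
    ζ (k * h) Y =
      ζ h (Y + formalPushforward h⁻¹ (ζ k (gaugeAction h Y) - gaugeAction h Y)) := by
  rw [hζ.cocycle]
  change ζ h (gaugeAction h⁻¹ (ζ k (gaugeAction h Y))) = _
  -- Expand ζ_k(h_L Y) around h_L Y: the affine map of h⁻¹ sends the base point back to Y and acts
  -- on the difference through its linear part.
  conv_lhs => rw [← add_sub_cancel (gaugeAction h Y) (ζ k (gaugeAction h Y)), gaugeAction_add,
    ← gaugeAction_mul, inv_mul_cancel, gaugeAction_one]

/-- Adding F to Y adds h_*F to h_L Y. As h_*F lies over K, away from supp k, it passes through ζ_k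
and cancels in the correction of `IsAnomalyMap.mul_apply`. What remains is additivity of ζ_h for F
and that correction, which lies over supp k. -/
theorem IsAnomalyMap.mul_apply_add (hζ : IsAnomalyMap ζ) (k h : gaugeGroup d n M)
    {F : FormalFunctionals n g σ} {K : Set M} (hK : IsClosed K) (hF : F.Insensitive K)
    (hd : Disjoint K (gaugeSupport k)) (Y : FormalFunctionals n g σ) :
    ζ (k * h) (Y + F) = ζ h (Y + F) - ζ h Y + ζ (k * h) Y := by
  rw [hζ.mul_apply, hζ.mul_apply k h Y, gaugeAction_add,
    hζ.apply_add hK (hF.formalPushforward h) hd, add_sub_add_right_eq_sub]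
  exact hζ.apply_add_add h hK (isClosed_mulTSupport k.1) hF
    ((hζ.sub_insensitive k _).formalPushforward h⁻¹) hd Y

/-- Put Q = ζ_{k₁}(P) - P, a functional over supp k₁. Passing from P to its image under k₂ changes
it only over supp k₂, which does not affect the difference Q. Moreover k₂⁻¹ fixes Q, and ζ_{k₂} lets
Q pass through, so the cocycle relation gives ζ_{k₁k₂}(P) = ζ_{k₂}(P) + Q. -/
theorem IsAnomalyMap.mul_apply_of_disjoint (hζ : IsAnomalyMap ζ) {k₁ k₂ : gaugeGroup d n M}
    (hd : Disjoint (gaugeSupport k₁) (gaugeSupport k₂)) (P : FormalFunctionals n g σ) :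
    ζ (k₁ * k₂) P - P = (ζ k₁ P - P) + (ζ k₂ P - P) := by
  have hQ := hζ.sub_insensitive k₁ P
  have h1 : ζ k₁ (gaugeAction k₂ P) - gaugeAction k₂ P = ζ k₁ P - P := by
    -- The argument of ζ_{k₁} is split as P plus the change made by k₂, which lies away from supp
    -- k₁.
    have := hζ.apply_add (isClosed_mulTSupport k₂.1) (gaugeAction_sub_insensitive k₂ P) hd.symm P
    rw [add_sub_cancel] at this
    rw [this]
    abel
  rw [hζ.mul_apply, h1, hQ.formalPushforward_eq (h := k₂⁻¹) (by rwa [gaugeSupport_inv]),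
    hζ.apply_add (isClosed_mulTSupport k₁.1) hQ hd]
  abel

/-- By `IsAnomalyMap.mul_apply_of_disjoint` at P = h_L Y, the correction for k₁k₂ is the sum of
those for k₁ and k₂. These lie over disjoint sets, so ζ_h is additive on them. -/
theorem IsAnomalyMap.mul_mul_apply (hζ : IsAnomalyMap ζ) {k₁ k₂ : gaugeGroup d n M}
    (hd : Disjoint (gaugeSupport k₁) (gaugeSupport k₂)) (h : gaugeGroup d n M)
    (Y : FormalFunctionals n g σ) :
    ζ (k₁ * k₂ * h) Y = ζ (k₁ * h) Y - ζ h Y + ζ (k₂ * h) Y := by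
  have hadd : ∀ F G : FormalFunctionals n g σ, formalPushforward h⁻¹ (F + G) =
      formalPushforward h⁻¹ F + formalPushforward h⁻¹ G := fun _ _ => rfl
  rw [hζ.mul_apply, hζ.mul_apply k₁ h Y, hζ.mul_apply k₂ h Y, hζ.mul_apply_of_disjoint hd, hadd,
    ← add_assoc]
  exact hζ.apply_add_add h (isClosed_mulTSupport k₁.1) (isClosed_mulTSupport k₂.1)
    ((hζ.sub_insensitive k₁ _).formalPushforward h⁻¹)
    ((hζ.sub_insensitive k₂ _).formalPushforward h⁻¹) hd Y

end Renormalization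

end

end PAQFT


/-! ### The six locality identities. -/

theorem proposition3p1 {d n : ℕ} {M : Type*} [TopologicalSpace M] [T2Space M]
    [SecondCountableTopology M] [ChartedSpace (Coord d) M] [IsManifold (𝓡 d) ∞ M]
    (met : PseudoMetric d M) {σ : Type*}
    (ζ : gaugeGroup d n M → Equiv.Perm (FormalFunctionals n met σ)) (hζ : IsAnomalyMap ζ) :
    let V : gaugeFields d n M → FormalFunctionals n met σ := fun A => .ofLocal σ (interaction met A)
    (∀ (h : gaugeGroup d n M) (A a₁ a₂ : gaugeFields d n M),
      Disjoint (gaugeFieldSupport a₁) (gaugeFieldSupport a₂) →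
        ζ h (V (A + a₁ + a₂)) = ζ h (V (A + a₁)) - ζ h (V A) + ζ h (V (A + a₂))) ∧
    (∀ (g h : gaugeGroup d n M) (A a : gaugeFields d n M),
      Disjoint (gaugeFieldSupport a) (gaugeSupport g) →
        ζ (g * h) (V (A + a)) = ζ h (V (A + a)) - ζ h (V A) + ζ (g * h) (V A)) ∧
    (∀ (g₁ g₂ h : gaugeGroup d n M) (A : gaugeFields d n M),
      Disjoint (gaugeSupport g₁) (gaugeSupport g₂) →
        ζ (g₁ * g₂ * h) (V A) = ζ (g₁ * h) (V A) - ζ h (V A) + ζ (g₂ * h) (V A)) ∧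
    (∀ (h : gaugeGroup d n M) (A a₁ a₂ : gaugeFields d n M),
      Disjoint (gaugeFieldSupport a₁) (gaugeFieldSupport a₂) →
        anomaly ζ h (A + a₁ + a₂) =
          anomaly ζ h (A + a₁) - anomaly ζ h A + anomaly ζ h (A + a₂)) ∧
    (∀ (g h : gaugeGroup d n M) (A a : gaugeFields d n M),
      Disjoint (gaugeFieldSupport a) (gaugeSupport g) →
        anomaly ζ (g * h) (A + a) =
          anomaly ζ h (A + a) - anomaly ζ h A + anomaly ζ (g * h) A) ∧
    (∀ (g₁ g₂ h : gaugeGroup d n M) (A : gaugeFields d n M),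
      Disjoint (gaugeSupport g₁) (gaugeSupport g₂) →
        anomaly ζ (g₁ * g₂ * h) A =
          anomaly ζ (g₁ * h) A - anomaly ζ h A + anomaly ζ (g₂ * h) A) := by
  intro V
  have hV : ∀ A a₁ a₂ : gaugeFields d n M,
      Disjoint (gaugeFieldSupport a₁) (gaugeFieldSupport a₂) →
        V (A + a₁ + a₂) = V (A + a₁) - V A + V (A + a₂) := by
    intro A a₁ a₂ hd
    simp only [V]
    rw [interaction_local A a₁ a₂ hd, FormalFunctionals.ofLocal_add, FormalFunctionals.ofLocal_sub]
  have h1 : ∀ (h : gaugeGroup d n M) (A a₁ a₂ : gaugeFields d n M),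
      Disjoint (gaugeFieldSupport a₁) (gaugeFieldSupport a₂) →
        ζ h (V (A + a₁ + a₂)) = ζ h (V (A + a₁)) - ζ h (V A) + ζ h (V (A + a₂)) := by
    intro h A a₁ a₂ hd
    -- Additivity around the base point V(A), with the increments V(A + aᵢ) - V(A).
    have := hζ.apply_add_add h isClosed_closure isClosed_closure
      (interaction_add_sub_insensitive A a₁) (interaction_add_sub_insensitive A a₂) hd (V A)
    simp only [V, add_sub_cancel] at this
    rw [← this, hV A a₁ a₂ hd]
    congr 1
    simp only [V]
    abel
  have h2 : ∀ (g h : gaugeGroup d n M) (A a : gaugeFields d n M),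
      Disjoint (gaugeFieldSupport a) (gaugeSupport g) →
        ζ (g * h) (V (A + a)) = ζ h (V (A + a)) - ζ h (V A) + ζ (g * h) (V A) := by
    intro g h A a hd
    have := hζ.mul_apply_add g h isClosed_closure (interaction_add_sub_insensitive A a) hd (V A)
    simpa only [V, add_sub_cancel] using this
  have h3 : ∀ (g₁ g₂ h : gaugeGroup d n M) (A : gaugeFields d n M),
      Disjoint (gaugeSupport g₁) (gaugeSupport g₂) →
        ζ (g₁ * g₂ * h) (V A) = ζ (g₁ * h) (V A) - ζ h (V A) + ζ (g₂ * h) (V A) :=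
    fun _ _ h A hd => hζ.mul_mul_apply hd h (V A)
  refine ⟨h1, h2, h3, fun h A a₁ a₂ hd => ?_, fun g h A a hd => ?_, fun g₁ g₂ h A hd => ?_⟩
  · change ζ h (V _) - V _ = ζ h (V _) - V _ - (ζ h (V _) - V _) + (ζ h (V _) - V _)
    -- Here the subtracted terms are at four different gauge fields, so `hV` is needed; in the other
    -- two cases they cancel identically.
    rw [h1 h A a₁ a₂ hd, hV A a₁ a₂ hd]
    abel
  · change ζ _ (V _) - V _ = ζ h (V _) - V _ - (ζ h (V _) - V _) + (ζ _ (V _) - V _)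
    rw [h2 g h A a hd]
    abel
  · change ζ _ (V _) - V _ = ζ _ (V _) - V _ - (ζ h (V _) - V _) + (ζ _ (V _) - V _)
    rw [h3 g₁ g₂ h A hd]
    abel
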